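/- Let $\Sigma$ be an oriented surface with a complete hyperbolic metric and let $p:\mathbb H\to\Sigma$ be its universal covering by the hyperbolic plane, a local isometry whose deck transformations are orientation-preserving isometries. A closed directed geodesic is a unit-speed geodesic $\mathbb R\to\Sigma$ together with a period $\ell>0$, its length ($\ell$ need not be the least period). Let $x$ and $y$ be closed directed geodesics of lengths $\ell_x,\ell_y$ with $x(s)=P=y(t)$, and assume that $y$ is not $x$ run backwards from $P$ (that is, not both $\ell_y=\ell_x$ and $y(t+u)=x(s-u)$ for all $u$); this holds in particular if $x$ and $y$ cross transversally at $P$ at these parameters. The midpoints of $x$ and $y$ with respect to $P$ are $P_x=x(s+\ell_x/2)$ and $P_y=y(t+\ell_y/2)$. The loop product $x*_Py$ goes once around $x$ from $P$ and then once around $y$. Let $P'\in\mathbb H$ be a lift of $P$ and let $\tilde x,\tilde y$ be the lifts of $x,y$ with $\tilde x(s)=\tilde y(t)=P'$. Let $\alpha\in[0,\pi]$ be the angle at $P'$ between the reversed direction of $\tilde x$ and the direction of $\tilde y$. Then there are deck transformations $X$ and $Y$ that are hyperbolic with directed axes $\tilde x$, $\tilde y$ and translation lengths $\ell_x$, $\ell_y$.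 Let $S$ be the midpoint of the $x$-segment from $P'$ to $XP'$ and $T$ the midpoint of the following $y$-segment from $XP'$ to $XYP'$ (these are two consecutive segments of the zigzag that lifts $x*_Py$ from $P'$). Then: 1. $X\circ Y$ (first $Y$, then $X$) and $Y\circ X$ are hyperbolic, with the same translation length $\ell_{xy}>0$. 2. The axis of $X\circ Y$ is the line through $S$ and $T$, directed from $S$ to $T$. Likewise, the axis of $Y\circ X$ is the line directed from $X^{-1}S$ to $X^{-1}T$, the midpoints of the $x$-segment from $X^{-1}P'$ to $P'$ and of the $y$-segment from $P'$ to $YP'$. 3. The projection of the axis of $X\circ Y$ to $\Sigma$, with length $\ell_{xy}$, is a closed directed geodesic in the free homotopy class of $x*_Py$, and it is the only one: every closed directed geodesic in that class has length $\ell_{xy}$ and differs from it only by a shift of the parameter. 4. $p(S)=P_x$ and $p(T)=P_y$. So this closed geodesic passes through $P_x$ and, half its length later, through $P_y$. 5. $\ell_{xy}=2\,d(S,T)$ and $$\cosh\frac{\ell_{xy}}2=\cosh\frac{\ell_x}2\cosh\frac{\ell_y}2-\sinh\frac{\ell_x}2\sinh\frac{\ell_y}2\cos\alpha .$$ -/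

import Mathlib

open scoped UpperHalfPlane MatrixGroups unitInterval

/-- A complete oriented hyperbolic surface `M` together with its universal covering
`proj : ℍ → M`: a covering map from the hyperbolic plane onto `M` all of whose deck
transformations are orientation-preserving isometries of `ℍ`, i.e. Möbius transformations
`z ↦ (a z + b) / (c z + d)` with `a, b, c, d` real and `a d - b c = 1`.
The hyperbolic metric and the orientation of `M` are those that make `proj` a local isometry
preserving orientation. -/
structure HyperbolicSurface (M : Type*) [TopologicalSpace M] where
  /-- the universal covering map -/
  proj : ℍ → M
  isCoveringMap : IsCoveringMap proj
  surjective : Function.Surjective proj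
  deck_mobius : ∀ φ : ℍ ≃ₜ ℍ, (∀ z, proj (φ z) = proj z) →
    ∃ g : SL(2, ℝ), ∀ z : ℍ, φ z = g • z

namespace HyperbolicSurface

variable {M : Type*} [TopologicalSpace M]

/-- Deck transformations of the universal covering. -/
def IsDeck (F : HyperbolicSurface M) (φ : ℍ ≃ₜ ℍ) : Prop :=
  ∀ z, F.proj (φ z) = F.proj z

/-- A closed directed geodesic of positive length `length`, parametrized by arc length on `ℝ` with
period `length`. (`length` need not be the smallest period, so that powers are allowed.)
The geodesics of `M` of unit speed are the projections of the geodesics of `ℍ` of unit speed,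
and the latter are the isometric embeddings `ℝ → ℍ`. -/
structure ClosedGeodesic (F : HyperbolicSurface M) where
  /-- the parametrization by arc length -/
  toFun : ℝ → M
  /-- the length -/
  length : ℝ
  length_pos : 0 < length
  periodic : Function.Periodic toFun length
  isGeodesic : ∃ c : ℝ → ℍ, Isometry c ∧ ∀ u, F.proj (c u) = toFun u

/-- `c` is a full lift of the closed geodesic `x` to the hyperbolic plane. -/
def IsLift {F : HyperbolicSurface M} (x : F.ClosedGeodesic) (c : ℝ → ℍ) : Prop :=
  Isometry c ∧ ∀ u, F.proj (c u) = x.toFun u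

namespace ClosedGeodesic

variable {F : HyperbolicSurface M}

theorem continuous_toFun (x : F.ClosedGeodesic) : Continuous x.toFun := by
  obtain ⟨c, hc, h⟩ := x.isGeodesic
  have : x.toFun = F.proj ∘ c := funext fun u => (h u).symm
  rw [this]
  exact F.isCoveringMap.continuous.comp hc.continuous

/-- The loop that starts at the point `P` of `x` with parameter `s` and goes once around `x`. -/
noncomputable def loopAt (x : F.ClosedGeodesic) (s : ℝ) (P : M) (h : x.toFun s = P) :
    Path P P where
  toFun u := x.toFun (s + (u : ℝ) * x.length)
  continuous_toFun := x.continuous_toFun.comp (by fun_prop)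
  source' := by simpa using h
  target' := by simpa using (x.periodic s).trans h

/-- The midpoint of `x` with respect to its point with parameter `s`: both arcs of `x` from that
point to the midpoint have length `x.length / 2`. -/
noncomputable def midpoint (x : F.ClosedGeodesic) (s : ℝ) : M :=
  x.toFun (s + x.length / 2)

/-- The loop product of `x` and `y` at the point `P`, which `x` passes at parameter `s` and `y` at
parameter `t`: once around `x` from `P`, then once around `y`. -/
noncomputable def loopProduct (x y : F.ClosedGeodesic) (s t : ℝ) (P : M)
    (hx : x.toFun s = P) (hy : y.toFun t = P) : Path P P :=
  (x.loopAt s P hx).trans (y.loopAt t P hy)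

/-- `x` lies in the free homotopy class of the loop `γ`. -/
def InFreeClass (x : F.ClosedGeodesic) {P : M} (γ : Path P P) : Prop :=
  ∃ H : C(I × I, M), (∀ u, H (0, u) = x.loopAt 0 (x.toFun 0) rfl u) ∧ (∀ u, H (1, u) = γ u) ∧
    ∀ r, H (r, 0) = H (r, 1)

end ClosedGeodesic

end HyperbolicSurface

/-- `φ` is a hyperbolic transformation of `ℍ` (a real Möbius transformation of determinant one with
`|trace| > 2`) whose directed axis is the geodesic `a` and whose translation length is `τ`: it moves
every point of `a` forward along `a` by the distance `τ`. -/
structure IsHyperbolicAlong (φ : ℍ → ℍ) (a : ℝ → ℍ) (τ : ℝ) : Prop where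
  hyperbolic : ∃ g : SL(2, ℝ), 2 < |(g : Matrix (Fin 2) (Fin 2) ℝ).trace| ∧ ∀ z : ℍ, φ z = g • z
  geodesic : Isometry a
  pos : 0 < τ
  translates : ∀ u, φ (a u) = a (u + τ)

/-- `S` is the midpoint of the geodesic segment from `A` to `B` in the hyperbolic plane. -/
def IsHypMidpoint (A S B : ℍ) : Prop :=
  dist A S = dist A B / 2 ∧ dist S B = dist A B / 2

/-- The velocity vector of a curve in `ℍ`, seen in the tangent space `ℂ`. -/
noncomputable def hypVelocity (c : ℝ → ℍ) (u : ℝ) : ℂ :=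
  deriv (fun v => (c v : ℂ)) u

/-- The angle between the reversed direction of `c` at parameter `s` and the direction of `d` at
parameter `t`, for two geodesics `c`, `d` of `ℍ` with `c s = d t`, i.e. the interior angle of a
geodesic polygon that arrives at the vertex along `c` and leaves it along `d`. (The upper half plane
model is conformal, so hyperbolic angles are Euclidean angles.) -/
noncomputable def turningInteriorAngle (c d : ℝ → ℍ) (s t : ℝ) : ℝ :=
  InnerProductGeometry.angle (-hypVelocity c s) (hypVelocity d t)

/-! A translation along a line is a product of two half-turns about points of that line lying half
the translation length apart. Let `T₀` be the point of the y-line half a period before P'. Then X =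
r_S r_P' and Y = r_P' r_T₀, so the half-turns about P' cancel and X ∘ Y = r_S r_T₀. This is the
translation along the line from `T₀` to `S` by 2 d(T₀, S), and it carries `T₀` to `T`, so d(S, T) =
d(T₀, S). The length formula is the law of cosines in the triangle T₀ P' S. The points `T₀` and `S`
coincide only if y is x run backwards, which is excluded. The half-turn argument is
`translation_comp_translation`.

For the free homotopy class, an axis is normalized to the imaginary axis, where the translation is a
Euclidean dilation. Dilations commute with convex combinations, which gives an equivariant homotopy
from the axis to the zigzag. Conversely, lifting a free homotopy shows that a closed geodesic in the
class has a lift translated by the same deck transformation. The trace determines the translation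
length, and only points of the axis are moved by exactly that length (`axis_unique`). -/

namespace UpperHalfPlane

/-! ### The imaginary axis as model geodesic -/

/-- The imaginary axis, parametrized by arc length. -/
noncomputable def imAxis (u : ℝ) : ℍ := ⟨⟨0, Real.exp u⟩, Real.exp_pos u⟩

theorem isometry_imAxis : Isometry imAxis := isometry_vertical_line 0

@[simp] theorem imAxis_re (u : ℝ) : (imAxis u).re = 0 := rfl
@[simp] theorem imAxis_im (u : ℝ) : (imAxis u).im = Real.exp u := rfl

theorem coe_imAxis (u : ℝ) : (imAxis u : ℂ) = Real.exp u * Complex.I := by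
  apply Complex.ext <;> simp [imAxis, Complex.exp_ofReal_re, Complex.exp_ofReal_im]

theorem imAxis_zero : imAxis 0 = UpperHalfPlane.I := by
  apply ext_re_im <;> simp

theorem cosh_dist_imAxis (z : ℍ) (u : ℝ) :
    Real.cosh (dist z (imAxis u)) * (2 * z.im * Real.exp u) =
      z.re ^ 2 + z.im ^ 2 + Real.exp u ^ 2 := by
  have h1 := z.im_pos
  have h2 := Real.exp_pos u
  rw [cosh_dist', imAxis_re, imAxis_im]
  field_simp
  ring

/-- The distances from `c w` to two points of the axis give two equations. Their difference
eliminates the squared modulus and yields the imaginary part; the real part then vanishes. -/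
theorem isometry_eq_imAxis {c : ℝ → ℍ} (hc : Isometry c) {u v : ℝ} (huv : u ≠ v)
    (hu : c u = imAxis u) (hv : c v = imAxis v) (w : ℝ) : c w = imAxis w := by
  have key : ∀ r, c r = imAxis r → (c w).re ^ 2 + (c w).im ^ 2 + Real.exp r ^ 2 =
      (c w).im * (Real.exp w + Real.exp r ^ 2 * Real.exp (-w)) := by
    intro r hr
    rw [← cosh_dist_imAxis, ← hr, hc.dist_eq, Real.dist_eq, Real.cosh_abs, Real.cosh_eq,
      neg_sub, Real.exp_sub, Real.exp_sub, Real.exp_neg]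
    have := Real.exp_pos r
    have := Real.exp_pos w
    field_simp
  have h1 := key u hu
  have h2 := key v hv
  have hne : Real.exp u ^ 2 - Real.exp v ^ 2 ≠ 0 := by
    rw [sub_ne_zero]
    intro h
    exact huv (Real.exp_injective ((pow_left_inj₀ (Real.exp_pos u).le (Real.exp_pos v).le
      two_ne_zero).1 h))
  have h3 : (c w).im * Real.exp (-w) = 1 := by
    apply mul_left_cancel₀ hne
    linarith
  have h4 : (c w).im = Real.exp w := by
    rw [Real.exp_neg, ← div_eq_mul_inv, div_eq_one_iff_eq (Real.exp_pos w).ne'] at h3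
    exact h3
  have h5 : (c w).re ^ 2 = 0 := by
    rw [Real.exp_neg] at h1
    rw [h4] at h1
    have := Real.exp_pos w
    field_simp at h1
    linarith
  exact ext_re_im (by simpa using h5) (by simpa using h4)

/-! ### Möbius action on the axis and rotations about i -/

theorem coe_SL_smul (g : SL(2, ℝ)) (z : ℍ) :
    ((g • z : ℍ) : ℂ) = (g 0 0 * z + g 0 1) / (g 1 0 * z + g 1 1) := by
  simpa using coe_specialLinearGroup_apply g z

theorem SL_denom_ne_zero (g : SL(2, ℝ)) (z : ℍ) : (g 1 0 * z + g 1 1 : ℂ) ≠ 0 :=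
  denom_ne_zero (g : GL (Fin 2) ℝ) z

theorem SL_smul_eq_iff (g : SL(2, ℝ)) (z w : ℍ) :
    g • z = w ↔ (g 0 0 * z + g 0 1 : ℂ) = w * (g 1 0 * z + g 1 1) := by
  rw [← coe_inj, coe_SL_smul, div_eq_iff (SL_denom_ne_zero g z)]

theorem SL_det (g : SL(2, ℝ)) : g 0 0 * g 1 1 - g 0 1 * g 1 0 = 1 := by
  rw [← Matrix.det_fin_two, g.det_coe]

theorem SL_smul_imAxis_eq_imAxis_iff (g : SL(2, ℝ)) (u v : ℝ) :
    g • imAxis u = imAxis v ↔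
      g 0 1 = - (Real.exp v * Real.exp u * g 1 0) ∧ g 0 0 * Real.exp u = Real.exp v * g 1 1 := by
  rw [SL_smul_eq_iff, coe_imAxis, coe_imAxis, Complex.ext_iff]
  simp only [Complex.add_re, Complex.mul_re, Complex.ofReal_re, Complex.ofReal_im, Complex.I_re,
    Complex.I_im, Complex.mul_im, Complex.add_im]
  constructor <;> rintro ⟨h1, h2⟩ <;> constructor <;> linarith

/-- The rotation about `i` given by a unit vector. -/
def rot (p q : ℝ) (h : p ^ 2 + q ^ 2 = 1) : SL(2, ℝ) :=
  ⟨!![p, -q; q, p], by rw [Matrix.det_fin_two_of]; linarith⟩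

theorem coe_rot (p q : ℝ) (h : p ^ 2 + q ^ 2 = 1) :
    (rot p q h : Matrix (Fin 2) (Fin 2) ℝ) = !![p, -q; q, p] := rfl

theorem eq_rot_of_smul_I (g : SL(2, ℝ)) (h : g • UpperHalfPlane.I = UpperHalfPlane.I) :
    ∃ p q, ∃ hpq : p ^ 2 + q ^ 2 = 1, g = rot p q hpq := by
  rw [← imAxis_zero, SL_smul_imAxis_eq_imAxis_iff] at h
  simp only [Real.exp_zero, mul_one, one_mul] at h
  have hd := SL_det g
  refine ⟨g 0 0, g 1 0, by rw [h.1, ← h.2] at hd; linarith, ?_⟩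
  ext i j
  fin_cases i <;> fin_cases j <;> simp [rot, h.1, h.2]

theorem rot_smul_I (p q : ℝ) (h : p ^ 2 + q ^ 2 = 1) :
    rot p q h • UpperHalfPlane.I = UpperHalfPlane.I := by
  rw [← imAxis_zero, SL_smul_imAxis_eq_imAxis_iff]
  simp [rot]

theorem rot_comm (p q p' q' : ℝ) (h : p ^ 2 + q ^ 2 = 1) (h' : p' ^ 2 + q' ^ 2 = 1) :
    rot p q h * rot p' q' h' = rot p' q' h' * rot p q h := by
  ext i j
  fin_cases i <;> fin_cases j <;> simp [coe_rot, Matrix.SpecialLinearGroup.coe_mul, Matrix.mul_apply,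
    Fin.sum_univ_two] <;> ring

theorem rot_zero_one_smul_imAxis (v : ℝ) :
    rot 0 1 (by norm_num) • imAxis v = imAxis (-v) := by
  rw [SL_smul_imAxis_eq_imAxis_iff]
  simp [rot, ← Real.exp_add]

theorem exists_rot_smul_eq_imAxis (z : ℍ) :
    ∃ p q, ∃ h : p ^ 2 + q ^ 2 = 1, ∃ u, rot p q h • z = imAxis u := by
  -- With z = x + iy, the rotated point is purely imaginary iff pq(|z|² - 1) + (p² - q²)x = 0. In
  -- double angles this says that (p² - q², -2pq) is parallel to ζ, hence half the argument of ζ.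
  set ζ : ℂ := ⟨z.re ^ 2 + z.im ^ 2 - 1, 2 * z.re⟩ with hζ
  set θ := ζ.arg with hθ
  set p := Real.cos (θ / 2)
  set q := -Real.sin (θ / 2)
  have h : p ^ 2 + q ^ 2 = 1 := by
    simp only [p, q, neg_sq]; exact Real.cos_sq_add_sin_sq _
  have e1 : ‖ζ‖ * (p ^ 2 - q ^ 2) = z.re ^ 2 + z.im ^ 2 - 1 := by
    have := Complex.norm_mul_cos_arg ζ
    rw [← hθ, show θ = 2 * (θ / 2) by ring, Real.cos_two_mul'] at this
    simpa only [p, q, neg_sq] using this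
  have e2 : ‖ζ‖ * (-2 * p * q) = 2 * z.re := by
    have := Complex.norm_mul_sin_arg ζ
    rw [← hθ, show θ = 2 * (θ / 2) by ring, Real.sin_two_mul] at this
    have h2 : ζ.im = 2 * z.re := rfl
    rw [← h2, ← this]
    simp only [p, q]
    ring
  refine ⟨p, q, h, Real.log (rot p q h • z).im, ?_⟩
  apply ext_re_im
  · rw [imAxis_re, ← coe_re, coe_SL_smul, Complex.div_re, ← add_div, div_eq_zero_iff]
    left
    simp only [rot, Matrix.of_apply, Matrix.cons_val', Matrix.cons_val_zero, Matrix.cons_val_one,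
      Matrix.cons_val_fin_one, Complex.add_re, Complex.mul_re, Complex.ofReal_re,
      Complex.ofReal_im, Complex.mul_im, Complex.add_im, coe_re, coe_im]
    have : p * q * (‖ζ‖ * (p ^ 2 - q ^ 2)) + (p ^ 2 - q ^ 2) * (‖ζ‖ * (-2 * p * q)) / 2 = 0 := by
      ring
    rw [e1, e2] at this
    linarith
  · rw [imAxis_im, Real.exp_log (im_pos _)]

/-- Two points of the hyperbolic plane lie on a geodesic line, and `SL(2, ℝ)` is transitive on
lines. -/
theorem exists_smul_imAxis (z w : ℍ) :
    ∃ g : SL(2, ℝ), g • imAxis 0 = z ∧ g • imAxis (dist z w) = w := by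
  set g₁ := z.toSL2R
  have h1 : g₁ • UpperHalfPlane.I = z := z.toSL2R_smul_I
  obtain ⟨p, q, h, u, hu⟩ := exists_rot_smul_eq_imAxis (g₁⁻¹ • w)
  set k := rot p q h
  have hk : k⁻¹ • UpperHalfPlane.I = UpperHalfPlane.I := by
    rw [inv_smul_eq_iff]; exact (rot_smul_I p q h).symm
  have hw : (g₁ * k⁻¹) • imAxis u = w := by rw [← hu, mul_smul, inv_smul_smul, smul_inv_smul]
  have hz : (g₁ * k⁻¹) • imAxis 0 = z := by rw [imAxis_zero, mul_smul, hk, h1]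
  have hd : dist z w = |u| := by
    nth_rewrite 1 [← hz, ← hw]
    rw [dist_smul, isometry_imAxis.dist_eq, Real.dist_eq, zero_sub, abs_neg]
  rcases abs_cases u with ⟨hu', -⟩ | ⟨hu', -⟩
  · exact ⟨g₁ * k⁻¹, hz, by rw [hd, hu', hw]⟩
  -- The half-turn about i exchanges the two rays of the axis and makes the parameter nonnegative.
  · refine ⟨g₁ * k⁻¹ * rot 0 1 (by norm_num), ?_, ?_⟩
    · rw [mul_smul, rot_zero_one_smul_imAxis, neg_zero, hz]
    · rw [hd, hu', mul_smul, rot_zero_one_smul_imAxis, neg_neg, hw]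

theorem isometry_smul_imAxis (g : SL(2, ℝ)) : Isometry fun u => g • imAxis u :=
  (isometry_smul ℍ g).comp isometry_imAxis

theorem exists_eq_smul_imAxis {c : ℝ → ℍ} (hc : Isometry c) :
    ∃ g : SL(2, ℝ), ∀ u, c u = g • imAxis u := by
  obtain ⟨g, h0, h1⟩ := exists_smul_imAxis (c 0) (c 1)
  rw [hc.dist_eq, Real.dist_eq, zero_sub, abs_neg, abs_one] at h1
  refine ⟨g, fun u => ?_⟩
  rw [← inv_smul_eq_iff]
  refine isometry_eq_imAxis (c := fun u => g⁻¹ • c u) ((isometry_smul ℍ g⁻¹).comp hc) zero_ne_one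
    ?_ ?_ u
  · rw [← h0, inv_smul_smul]
  · rw [← h1, inv_smul_smul]

/-- A geodesic is the image of the imaginary axis, with any parameter as the origin. -/
theorem exists_eq_smul_imAxis_sub {c : ℝ → ℍ} (hc : Isometry c) (s : ℝ) :
    ∃ g : SL(2, ℝ), ∀ u, c (s + u) = g • imAxis u :=
  exists_eq_smul_imAxis (c := fun u => c (s + u)) (hc.comp (isometry_add_left s))

/-- Two geodesic lines which agree at two parameters agree. -/
theorem isometry_ext {c d : ℝ → ℍ} (hc : Isometry c) (hd : Isometry d) {u v : ℝ} (huv : u ≠ v)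
    (hu : c u = d u) (hv : c v = d v) (w : ℝ) : c w = d w := by
  obtain ⟨g, hg⟩ := exists_eq_smul_imAxis hd
  rw [hg, ← inv_smul_eq_iff]
  refine isometry_eq_imAxis (c := fun u => g⁻¹ • c u) ((isometry_smul ℍ g⁻¹).comp hc) huv ?_ ?_ w
  · rw [inv_smul_eq_iff, hu, hg]
  · rw [inv_smul_eq_iff, hv, hg]

/-- The point reflection at `P` reverses all geodesics through `P`. -/
theorem exists_pointReflection (P : ℍ) : ∃ r : SL(2, ℝ), ∀ (c : ℝ → ℍ), Isometry c →
    ∀ s, c s = P → ∀ v, r • c (s + v) = c (s - v) := by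
  set h := P.toSL2R
  have h1 : h • UpperHalfPlane.I = P := P.toSL2R_smul_I
  refine ⟨h * rot 0 1 (by norm_num) * h⁻¹, fun c hc s hs v => ?_⟩
  obtain ⟨g, hg⟩ := exists_eq_smul_imAxis_sub hc s
  have h0 : (h⁻¹ * g) • UpperHalfPlane.I = UpperHalfPlane.I := by
    rw [mul_smul, ← imAxis_zero, ← hg, add_zero, hs, imAxis_zero, ← h1, inv_smul_smul]
  obtain ⟨p, q, hpq, e⟩ := eq_rot_of_smul_I _ h0
  -- Geodesics through P differ by rotations about P; these commute with the half-turn, so one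
  -- half-turn reverses all of them.
  have hcomm := rot_comm 0 1 p q (by norm_num) hpq
  rw [← e] at hcomm
  rw [sub_eq_add_neg, hg, hg, ← mul_smul, mul_assoc, mul_assoc, hcomm, mul_assoc,
    mul_inv_cancel_left, mul_smul, rot_zero_one_smul_imAxis]

/-! ### Translations along a line: trace, length and axis -/

theorem of_translates_imAxis {g : SL(2, ℝ)} {τ : ℝ} (h : ∀ u, g • imAxis u = imAxis (u + τ)) :
    g 0 1 = 0 ∧ g 1 0 = 0 ∧ g 0 0 = Real.exp τ * g 1 1 := by
  have h0 := (SL_smul_imAxis_eq_imAxis_iff _ _ _).1 (h 0)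
  have h1 := (SL_smul_imAxis_eq_imAxis_iff _ _ _).1 (h 1)
  simp only [zero_add, Real.exp_zero, mul_one] at h0
  have hc : g 1 0 = 0 := by
    have h2 := h0.1.symm.trans h1.1
    rw [Real.exp_add] at h2
    have h3 : Real.exp τ * (Real.exp 1 ^ 2 - 1) * g 1 0 = 0 := by linarith
    have h4 : Real.exp 1 ^ 2 - 1 ≠ 0 := by
      have := Real.add_one_lt_exp one_ne_zero
      nlinarith
    exact (mul_eq_zero.1 h3).resolve_left (mul_ne_zero (Real.exp_pos τ).ne' h4)
  exact ⟨by simpa [hc] using h0.1, hc, h0.2⟩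

theorem coe_smul_of_translates_imAxis {g : SL(2, ℝ)} {τ : ℝ}
    (h : ∀ u, g • imAxis u = imAxis (u + τ)) (z : ℍ) : ((g • z : ℍ) : ℂ) = Real.exp τ * z := by
  obtain ⟨h1, h2, h3⟩ := of_translates_imAxis h
  have hd := SL_det g
  have h4 : g 1 1 ≠ 0 := by
    intro h4; simp [h1, h4] at hd
  rw [coe_SL_smul, h1, h2, h3]
  push_cast
  have h4' : (g 1 1 : ℂ) ≠ 0 := by exact_mod_cast h4
  rw [zero_mul, zero_add, add_zero, mul_right_comm, mul_div_cancel_right₀ _ h4']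

/-- The square appears because `g` and `-g` act identically, so the action fixes the trace only up
to sign. -/
theorem trace_sq_of_translates_imAxis {g : SL(2, ℝ)} {τ : ℝ}
    (h : ∀ u, g • imAxis u = imAxis (u + τ)) :
    (g : Matrix (Fin 2) (Fin 2) ℝ).trace ^ 2 = (2 * Real.cosh (τ / 2)) ^ 2 := by
  obtain ⟨h1, h2, h3⟩ := of_translates_imAxis h
  have hd := SL_det g
  rw [Matrix.trace_fin_two]
  rw [h1, h3] at hd
  rw [h3, Real.cosh_eq, Real.exp_neg]
  have h5 : Real.exp τ = Real.exp (τ / 2) ^ 2 := by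
    rw [← Real.exp_nat_mul]; congr 1; push_cast; ring
  rw [h5] at hd ⊢
  have := Real.exp_pos (τ / 2)
  set e := Real.exp (τ / 2)
  have h6 : (g 1 1) ^ 2 = (e ^ 2)⁻¹ := by
    rw [← mul_eq_one_iff_eq_inv₀ (by positivity)]; linarith
  calc (e ^ 2 * g 1 1 + g 1 1) ^ 2 = (e ^ 2 + 1) ^ 2 * (g 1 1) ^ 2 := by ring
    _ = _ := by rw [h6]; field_simp

section Translation

variable {g g' : SL(2, ℝ)} {c : ℝ → ℍ} {τ : ℝ}

theorem conj_translates_imAxis {k : SL(2, ℝ)} (h : ∀ u, g • c u = c (u + τ))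
    (hk : ∀ u, c u = k • imAxis u) (u : ℝ) : (k⁻¹ * g * k) • imAxis u = imAxis (u + τ) := by
  rw [mul_smul, mul_smul, ← hk, h, hk, inv_smul_smul]

theorem trace_sq_of_translates (hc : Isometry c) (h : ∀ u, g • c u = c (u + τ)) :
    (g : Matrix (Fin 2) (Fin 2) ℝ).trace ^ 2 = (2 * Real.cosh (τ / 2)) ^ 2 := by
  obtain ⟨k, hk⟩ := exists_eq_smul_imAxis hc
  have h1 : k * (k⁻¹ * g) = g := mul_inv_cancel_left k g
  rw [← trace_sq_of_translates_imAxis (conj_translates_imAxis h hk),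
    Matrix.SpecialLinearGroup.coe_mul, Matrix.trace_mul_comm, ← Matrix.SpecialLinearGroup.coe_mul,
    h1]

/-- The quotient of the two maps translates the line by 0, so it is conjugate to the dilation by the
factor 1. -/
theorem smul_eq_of_eq_on_line (hc : Isometry c) (h : ∀ u, g • c u = g' • c u) (z : ℍ) :
    g • z = g' • z := by
  obtain ⟨k, hk⟩ := exists_eq_smul_imAxis hc
  have h1 := conj_translates_imAxis (g := g'⁻¹ * g) (τ := 0)
    (fun u => by rw [mul_smul, h, inv_smul_smul, add_zero]) hk
  have h2 := coe_smul_of_translates_imAxis h1 (k⁻¹ • z)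
  rw [Real.exp_zero, Complex.ofReal_one, one_mul, coe_inj, mul_smul, smul_inv_smul, mul_smul,
    smul_left_cancel_iff, mul_smul, inv_smul_eq_iff] at h2
  exact h2

theorem two_lt_abs_trace_of_translates (hc : Isometry c) (hτ : 0 < τ)
    (h : ∀ u, g • c u = c (u + τ)) : 2 < |(g : Matrix (Fin 2) (Fin 2) ℝ).trace| := by
  have h1 := sq_eq_sq_iff_abs_eq_abs _ _ |>.1 (trace_sq_of_translates hc h)
  have h2 : 1 < Real.cosh (τ / 2) := Real.one_lt_cosh.2 (by positivity)
  rw [h1, abs_of_pos (by positivity)]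
  linarith

theorem translation_length_unique {a : ℝ → ℍ} {ρ : ℝ} (hc : Isometry c) (ha : Isometry a)
    (hτ : 0 < τ) (hρ : 0 < ρ) (h : ∀ u, g • c u = c (u + τ)) (h' : ∀ u, g • a u = a (u + ρ)) :
    τ = ρ := by
  have h1 := (trace_sq_of_translates hc h).symm.trans (trace_sq_of_translates ha h')
  rw [pow_left_inj₀ (by positivity) (by positivity) two_ne_zero] at h1
  have h2 := Real.cosh_injOn (x₁ := τ / 2) (x₂ := ρ / 2) (Set.mem_Ici.2 (by positivity))
    (Set.mem_Ici.2 (by positivity)) (by linarith)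
  linarith

theorem axis_unique {a : ℝ → ℍ} {ρ : ℝ} (hc : Isometry c) (ha : Isometry a)
    (hτ : 0 < τ) (hρ : 0 < ρ) (h : ∀ u, g • c u = c (u + τ)) (h' : ∀ u, g • a u = a (u + ρ)) :
    ∃ u₀, ∀ u, c u = a (u + u₀) := by
  obtain rfl := translation_length_unique hc ha hτ hρ h h'
  obtain ⟨k, hk⟩ := exists_eq_smul_imAxis ha
  have h1 := conj_translates_imAxis h' hk
  have h2 := coe_smul_of_translates_imAxis h1
  set m := k⁻¹ * g * k
  set z := k⁻¹ • c 0 with hz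
  have h3 : m • z = k⁻¹ • c τ := by
    have := h 0
    rw [zero_add] at this
    rw [← this, hz, mul_smul, mul_smul, smul_inv_smul]
  have h4 : dist z (m • z) = τ := by
    rw [h3, dist_smul, hc.dist_eq, Real.dist_eq, zero_sub, abs_neg, abs_of_pos hτ]
  have hre : (m • z).re = Real.exp τ * z.re := by
    rw [← coe_re, h2, Complex.re_ofReal_mul, coe_re]
  have him : (m • z).im = Real.exp τ * z.im := by
    rw [← coe_im, h2, Complex.im_ofReal_mul, coe_im]
  -- The dilation by exp τ moves points off the imaginary axis by more than τ.
  have h5 : z.re = 0 := by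
    have h6 := cosh_dist' z (m • z)
    rw [h4, hre, him, Real.cosh_eq, Real.exp_neg] at h6
    have := z.im_pos
    have he : 1 < Real.exp τ := Real.one_lt_exp_iff.2 hτ
    set e := Real.exp τ
    field_simp at h6
    have h7 : (e - 1) ^ 2 * z.re ^ 2 = 0 := by linarith
    have h8 : (e - 1) ^ 2 ≠ 0 := pow_ne_zero _ (by linarith)
    simpa [h8] using h7
  have h6 : z = imAxis (Real.log z.im) :=
    ext_re_im (by simpa using h5) (by rw [imAxis_im, Real.exp_log z.im_pos])
  refine ⟨Real.log z.im, isometry_ext hc (ha.comp (isometry_add_right _)) hτ.ne ?_ ?_⟩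
  · rw [zero_add, hk, ← h6, hz, smul_inv_smul]
  · rw [hk, add_comm, ← h1, ← h6, h3, smul_inv_smul]

end Translation

/-! ### Velocities, angles and the law of cosines -/

theorem hasDerivAt_smul_imAxis (g : SL(2, ℝ)) :
    HasDerivAt (fun u => ((g • imAxis u : ℍ) : ℂ))
      (Complex.I / (g 1 0 * Complex.I + g 1 1) ^ 2) 0 := by
  have hd : (g 1 0 * Complex.I + g 1 1 : ℂ) ≠ 0 := by
    simpa [imAxis_zero] using SL_denom_ne_zero g UpperHalfPlane.I
  have he : HasDerivAt (fun u : ℝ => (Real.exp u * Complex.I : ℂ)) Complex.I 0 := by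
    simpa using ((Real.hasDerivAt_exp 0).ofReal_comp).mul_const Complex.I
  have h1 := ((he.const_mul (g 0 0 : ℂ)).add_const (g 0 1 : ℂ)).div
    ((he.const_mul (g 1 0 : ℂ)).add_const (g 1 1 : ℂ)) (by simpa using hd)
  simp only [coe_SL_smul, coe_imAxis]
  refine h1.congr_deriv ?_
  have hdet : (g 0 0 * g 1 1 - g 0 1 * g 1 0 : ℂ) = 1 := by exact_mod_cast SL_det g
  simp only [Real.exp_zero, Complex.ofReal_one, one_mul]
  congr 1
  linear_combination Complex.I * hdet

theorem hypVelocity_eq {c : ℝ → ℍ} {s : ℝ} {g : SL(2, ℝ)} (h : ∀ u, c (s + u) = g • imAxis u) :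
    hypVelocity c s = Complex.I / (g 1 0 * Complex.I + g 1 1) ^ 2 := by
  have h1 := hasDerivAt_smul_imAxis g
  simp only [← h] at h1
  have h2 := h1.deriv
  rw [deriv_comp_const_add (fun v => (c v : ℂ)), add_zero] at h2
  exact h2

/-- The law of cosines with vertex i: p² - q² is the cosine of the angle between the directions of
the axis and its rotated copy. The parameter -b selects a point before the vertex. -/
theorem cosh_dist_imAxis_rot_smul (a b p q : ℝ) (h : p ^ 2 + q ^ 2 = 1) :
    Real.cosh (dist (imAxis a) (rot p q h • imAxis (-b))) =
      Real.cosh a * Real.cosh b + Real.sinh a * Real.sinh b * (p ^ 2 - q ^ 2) := by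
  set z := rot p q h • imAxis (-b)
  have hz : (z : ℂ) = (p * (Real.exp (-b) * Complex.I) - q) /
      (q * (Real.exp (-b) * Complex.I) + p) := by
    rw [coe_SL_smul, coe_imAxis]
    simp [rot, sub_eq_add_neg]
  have ht := Real.exp_pos (-b)
  have hA := Real.exp_pos a
  have hb : Real.exp b = (Real.exp (-b))⁻¹ := by rw [Real.exp_neg, inv_inv]
  set t := Real.exp (-b)
  have hD : 0 < q ^ 2 * t ^ 2 + p ^ 2 := by
    by_cases hq : q = 0
    · subst hq
      have : p ^ 2 = 1 := by linarith
      rw [this]; positivity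
    · positivity
  have hN : Complex.normSq (q * (t * Complex.I) + p) = q ^ 2 * t ^ 2 + p ^ 2 := by
    rw [Complex.normSq_apply]; simp; ring
  have hre : z.re = p * q * (t ^ 2 - 1) / (q ^ 2 * t ^ 2 + p ^ 2) := by
    rw [← coe_re, hz, Complex.div_re, hN]; simp; ring
  have him : z.im = t / (q ^ 2 * t ^ 2 + p ^ 2) := by
    rw [← coe_im, hz, Complex.div_im, hN]; simp
    rw [← sub_div]; congr 1
    linear_combination t * h
  have hC := cosh_dist_imAxis z a
  rw [dist_comm, hre, him] at hC
  have hK : Real.cosh (dist (imAxis a) z) * (2 * t * Real.exp a) =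
      p ^ 2 * t ^ 2 + q ^ 2 + Real.exp a ^ 2 * (q ^ 2 * t ^ 2 + p ^ 2) := by
    obtain ⟨D, hDe⟩ : ∃ D, D = q ^ 2 * t ^ 2 + p ^ 2 := ⟨_, rfl⟩
    rw [← hDe] at hC hD ⊢
    field_simp at hC
    apply mul_left_cancel₀ hD.ne'
    linear_combination hC - t ^ 2 * (p ^ 2 + q ^ 2 + 1) * h - (p ^ 2 * t ^ 2 + q ^ 2) * hDe
  apply mul_right_cancel₀ (b := 2 * t * Real.exp a) (by positivity)
  rw [hK, Real.cosh_eq a, Real.sinh_eq a, Real.cosh_eq b, Real.sinh_eq b, hb, Real.exp_neg a]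
  change _ = (_ * ((_ + t) / 2) + _ * ((_ - t) / 2) * _) * _
  generalize Real.exp a = E at *
  field_simp
  linear_combination ((1 + t ^ 2) * (1 + E ^ 2)) * h

/-- The velocities differ by the unit factor (p - qi)², with real part p² - q²; reversing `c`
changes the sign. -/
theorem cos_turningInteriorAngle {c d : ℝ → ℍ} {s t p q : ℝ} {g : SL(2, ℝ)}
    {h : p ^ 2 + q ^ 2 = 1}
    (hc : ∀ u, c (s + u) = g • imAxis u) (hd : ∀ u, d (t + u) = (g * rot p q h) • imAxis u) :
    Real.cos (turningInteriorAngle c d s t) = -(p ^ 2 - q ^ 2) := by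
  have hv := hypVelocity_eq hc
  have hw := hypVelocity_eq hd
  have hden : (g 1 0 * Complex.I + g 1 1 : ℂ) ≠ 0 := by
    simpa [imAxis_zero] using SL_denom_ne_zero g UpperHalfPlane.I
  set v := hypVelocity c s
  set w := hypVelocity d t
  have hω : (p + q * Complex.I : ℂ) * (p - q * Complex.I) = 1 := by
    have h' : (p ^ 2 + q ^ 2 : ℂ) = 1 := by exact_mod_cast h
    linear_combination h' - (q : ℂ) ^ 2 * Complex.I_sq
  have hvw : w = v * (p - q * Complex.I) ^ 2 := by
    have e : (((g * rot p q h) 1 0 : ℝ) * Complex.I + ((g * rot p q h) 1 1 : ℝ) : ℂ) =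
        (g 1 0 * Complex.I + g 1 1) * (p + q * Complex.I) := by
      simp [coe_rot, Matrix.SpecialLinearGroup.coe_mul, Matrix.mul_apply, Fin.sum_univ_two]
      linear_combination (-(g 1 0 : ℂ) * q) * Complex.I_sq
    have h1 : (p + q * Complex.I : ℂ) ≠ 0 := left_ne_zero_of_mul_eq_one hω
    rw [hw, hv, e, mul_pow, div_mul_eq_mul_div, div_eq_div_iff (by positivity) (by positivity)]
    linear_combination (-Complex.I * (g 1 0 * Complex.I + g 1 1) ^ 2 *
      ((p + q * Complex.I : ℂ) * (p - q * Complex.I) + 1)) * hω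
  have hv0 : v ≠ 0 := by
    rw [hv]; exact div_ne_zero Complex.I_ne_zero (pow_ne_zero _ hden)
  have hn : ‖(p - q * Complex.I : ℂ) ^ 2‖ = 1 := by
    rw [norm_pow, Complex.sq_norm, Complex.normSq_apply]; simp; linarith
  change Real.cos (InnerProductGeometry.angle (-v) w) = _
  rw [InnerProductGeometry.cos_angle, inner_neg_left, norm_neg, hvw,
    norm_mul, hn, mul_one, ← sq, Complex.inner, mul_right_comm, Complex.mul_conj,
    Complex.re_ofReal_mul, Complex.sq_norm, neg_div,
    mul_div_cancel_left₀ _ (by simpa using hv0)]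
  congr 1
  simp [sq]

/-- The hyperbolic law of cosines. -/
theorem cosh_dist_geodesics {c d : ℝ → ℍ} (hc : Isometry c) (hd : Isometry d) {s t : ℝ}
    (hst : c s = d t) (a b : ℝ) :
    Real.cosh (dist (c (s + a)) (d (t - b))) = Real.cosh a * Real.cosh b -
      Real.sinh a * Real.sinh b * Real.cos (turningInteriorAngle c d s t) := by
  obtain ⟨g, hg⟩ := exists_eq_smul_imAxis_sub hc s
  obtain ⟨g', hg'⟩ := exists_eq_smul_imAxis_sub hd t
  have h0 : (g⁻¹ * g') • UpperHalfPlane.I = UpperHalfPlane.I := by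
    rw [mul_smul, ← imAxis_zero, ← hg', inv_smul_eq_iff, ← hg, add_zero, add_zero, hst]
  obtain ⟨p, q, hpq, e⟩ := eq_rot_of_smul_I _ h0
  rw [inv_mul_eq_iff_eq_mul] at e
  subst e
  rw [cos_turningInteriorAngle hg hg', sub_eq_add_neg t, hg, hg', mul_smul, dist_smul,
    cosh_dist_imAxis_rot_smul]
  ring

/-! ### Convex combinations for the homotopies -/

/-- The Euclidean convex combination of two points of the upper half plane. -/
def convexComb (r : I) (z w : ℍ) : ℍ :=
  ⟨(1 - (r : ℝ) : ℝ) * (z : ℂ) + (r : ℝ) * (w : ℂ), by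
    have h1 := z.im_pos
    have h2 := w.im_pos
    rw [Complex.add_im, Complex.im_ofReal_mul, Complex.im_ofReal_mul, coe_im, coe_im]
    rcases r.2.1.eq_or_lt with h | h
    · rw [← h]; simpa using h1
    · exact add_pos_of_nonneg_of_pos (mul_nonneg (sub_nonneg.2 r.2.2) h1.le) (mul_pos h h2)⟩

theorem coe_convexComb (r : I) (z w : ℍ) :
    (convexComb r z w : ℂ) = (1 - (r : ℝ) : ℝ) * (z : ℂ) + (r : ℝ) * (w : ℂ) := rfl

theorem continuous_convexComb : Continuous fun p : I × ℍ × ℍ => convexComb p.1 p.2.1 p.2.2 := by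
  rw [isEmbedding_coe.continuous_iff]
  have h := continuous_coe
  simp only [Function.comp_def, coe_convexComb]
  fun_prop

theorem convexComb_zero (z w : ℍ) : convexComb 0 z w = z := by
  rw [← coe_inj, coe_convexComb]; simp

theorem convexComb_one (z w : ℍ) : convexComb 1 z w = w := by
  rw [← coe_inj, coe_convexComb]; simp

theorem convexComb_smul {g : SL(2, ℝ)} {τ : ℝ} (h : ∀ z : ℍ, ((g • z : ℍ) : ℂ) = Real.exp τ * z)
    (r : I) (z w : ℍ) : convexComb r (g • z) (g • w) = g • convexComb r z w := by
  rw [← coe_inj, h, coe_convexComb, coe_convexComb, h, h]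
  ring

end UpperHalfPlane

open UpperHalfPlane

theorem IsHyperbolicAlong.of_translates {φ : ℍ → ℍ} {c : ℝ → ℍ} {τ : ℝ}
    (hφ : ∃ g : SL(2, ℝ), ∀ z, φ z = g • z) (hc : Isometry c) (hτ : 0 < τ)
    (h : ∀ u, φ (c u) = c (u + τ)) : IsHyperbolicAlong φ c τ := by
  obtain ⟨g, hg⟩ := hφ
  exact ⟨⟨g, two_lt_abs_trace_of_translates hc hτ fun u => by rw [← hg, h], hg⟩, hc, hτ, h⟩

/-! ### Deck transformations and lifts of closed geodesics -/

namespace HyperbolicSurface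

variable {M : Type*} [TopologicalSpace M] {F : HyperbolicSurface M}

/-- The covering lifts through itself because ℍ is simply connected. The lifts sending z to w and w
to z are mutually inverse by uniqueness of lifts. -/
theorem exists_isDeck_apply_eq (F : HyperbolicSurface M) {z w : ℍ} (h : F.proj z = F.proj w) :
    ∃ φ : ℍ ≃ₜ ℍ, F.IsDeck φ ∧ φ z = w := by
  have key : ∀ z w : ℍ, F.proj z = F.proj w → ∃ f : C(ℍ, ℍ), f z = w ∧ F.proj ∘ f = F.proj :=
    fun z w h => (F.isCoveringMap.existsUnique_continuousMap_lifts
      ⟨F.proj, F.isCoveringMap.continuous⟩ z w h.symm).exists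
  obtain ⟨f, hf, hf'⟩ := key z w h
  obtain ⟨f', hg, hg'⟩ := key w z h.symm
  have h1 : f' ∘ f = id := F.isCoveringMap.eq_of_comp_eq (by fun_prop) continuous_id
    (by rw [← Function.comp_assoc, hg', hf', Function.comp_id]) z (by simp [hf, hg])
  have h2 : f ∘ f' = id := F.isCoveringMap.eq_of_comp_eq (by fun_prop) continuous_id
    (by rw [← Function.comp_assoc, hf', hg', Function.comp_id]) w (by simp [hf, hg])
  exact ⟨⟨⟨f, f', congrFun h1, congrFun h2⟩, f.continuous, f'.continuous⟩, congrFun hf', hf⟩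

theorem IsDeck.isometry {φ : ℍ ≃ₜ ℍ} (hφ : F.IsDeck φ) : Isometry φ := by
  obtain ⟨g, hg⟩ := F.deck_mobius φ hφ
  exact (funext hg : ⇑φ = fun z => g • z) ▸ isometry_smul ℍ g

theorem IsDeck.trans {φ ψ : ℍ ≃ₜ ℍ} (hφ : F.IsDeck φ) (hψ : F.IsDeck ψ) :
    F.IsDeck (φ.trans ψ) := fun z => (hψ (φ z)).trans (hφ z)

/-- Both sides lift the same curve, by periodicity, and agree at parameter 0. -/
theorem IsLift.apply_add_length {x : F.ClosedGeodesic} {c : ℝ → ℍ} (hc : IsLift x c)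
    {φ : ℍ ≃ₜ ℍ} (hφ : F.IsDeck φ) (h : φ (c 0) = c x.length) (u : ℝ) :
    φ (c u) = c (u + x.length) := by
  have h1 : (φ ∘ c) = fun u => c (u + x.length) :=
    F.isCoveringMap.eq_of_comp_eq (φ.continuous.comp hc.1.continuous)
      (hc.1.continuous.comp (continuous_add_const _))
      (funext fun u => by
        simp only [Function.comp_apply]
        rw [hφ, hc.2, hc.2, x.periodic]) 0 (by simpa using h)
  exact congrFun h1 u

theorem IsLift.exists_isDeck {x : F.ClosedGeodesic} {c : ℝ → ℍ} (hc : IsLift x c) :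
    ∃ φ : ℍ ≃ₜ ℍ, F.IsDeck φ ∧ IsHyperbolicAlong φ c x.length := by
  obtain ⟨φ, hφ, h⟩ := F.exists_isDeck_apply_eq (z := c 0) (w := c x.length) (by
    rw [hc.2, hc.2, ← x.periodic, zero_add])
  exact ⟨φ, hφ, .of_translates (F.deck_mobius φ hφ) hc.1 x.length_pos (hc.apply_add_length hφ h)⟩

/-! ### Closed geodesics in a free homotopy class -/

/-- The projection of the axis of a deck transformation is freely homotopic to the projection of
any path from a point to its image. -/
theorem ClosedGeodesic.inFreeClass_of_axis {φ : ℍ ≃ₜ ℍ} {a : ℝ → ℍ}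
    {z : F.ClosedGeodesic} (hφ : F.IsDeck φ) (ha : IsHyperbolicAlong φ a z.length)
    (hz : ∀ u, z.toFun u = F.proj (a u)) {Q : ℍ} (β : Path Q (φ Q)) {P : M} (γ : Path P P)
    (hβ : ∀ u, F.proj (β u) = γ u) : z.InFreeClass γ := by
  obtain ⟨g, -, hg⟩ := ha.hyperbolic
  obtain ⟨k, hk⟩ := exists_eq_smul_imAxis ha.geodesic
  have h0 : ∀ u, g • a u = a (u + z.length) := fun u => by rw [← hg, ha.translates]
  have h1 := coe_smul_of_translates_imAxis (conj_translates_imAxis h0 hk)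
  have hcont : Continuous fun p : I × I => F.proj (k • convexComb p.1
      (k⁻¹ • a (p.2 * z.length)) (k⁻¹ • β p.2)) := by
    have h2 : Continuous fun u : I => k⁻¹ • a (u * z.length) :=
      (isometry_smul ℍ k⁻¹).continuous.comp (ha.geodesic.continuous.comp (by fun_prop))
    have h3 : Continuous fun u : I => k⁻¹ • β u :=
      (isometry_smul ℍ k⁻¹).continuous.comp β.continuous
    have h4 : Continuous fun p : I × I =>
        convexComb p.1 (k⁻¹ • a (p.2 * z.length)) (k⁻¹ • β p.2) :=
      continuous_convexComb.comp
        (continuous_fst.prodMk ((h2.comp continuous_snd).prodMk (h3.comp continuous_snd)))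
    exact F.isCoveringMap.continuous.comp ((isometry_smul ℍ k).continuous.comp h4)
  refine ⟨⟨_, hcont⟩, fun u => ?_, fun u => ?_, fun r => ?_⟩
  · simp [convexComb_zero, ClosedGeodesic.loopAt, hz]
  · simp [convexComb_one, hβ]
  -- The homotopy upstairs is equivariant, so its two ends differ by `φ` and have the same
  -- projection.
  · have e1 : a z.length = g • a 0 := by rw [← hg, ha.translates, zero_add]
    have e2 : ∀ p : ℍ, k⁻¹ • g • p = (k⁻¹ * g * k) • k⁻¹ • p := fun p => by
      rw [mul_smul, mul_smul, smul_inv_smul]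
    have e3 : ∀ p : ℍ, k • (k⁻¹ * g * k) • p = g • k • p := fun p => by
      rw [mul_smul, mul_smul, smul_inv_smul]
    simp only [ContinuousMap.coe_mk, Set.Icc.coe_zero, Set.Icc.coe_one, zero_mul, one_mul,
      β.source, β.target]
    rw [e1, hg, e2, e2, convexComb_smul h1, e3, ← hg, hφ]

/-- A closed geodesic freely homotopic to the projection of a path from a point to its image under
a hyperbolic deck transformation is the projection of the axis of this transformation. -/
theorem ClosedGeodesic.InFreeClass.eq_axis {φ : ℍ ≃ₜ ℍ} {a : ℝ → ℍ} {τ : ℝ}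
    (hφ : F.IsDeck φ) (ha : IsHyperbolicAlong φ a τ) {Q : ℍ} (β : Path Q (φ Q))
    {P : M} {γ : Path P P} (hβ : ∀ u, F.proj (β u) = γ u)
    {w : F.ClosedGeodesic} (hw : w.InFreeClass γ) :
    w.length = τ ∧ ∃ u₀, ∀ u, w.toFun u = F.proj (a (u + u₀)) := by
  obtain ⟨H, H0, H1, Hp⟩ := hw
  obtain ⟨g, -, hg⟩ := ha.hyperbolic
  -- The homotopy is reversed so that it starts at γ, whose lift β is known.
  let H' : C(I × I, M) := H.comp ⟨fun p => (σ p.1, p.2), by fun_prop⟩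
  have hH' : ∀ u, H' (0, u) = F.proj (β.toContinuousMap u) := fun u => by
    change H (σ 0, u) = F.proj (β u)
    rw [unitInterval.symm_zero, H1, hβ]
  let L := F.isCoveringMap.liftHomotopy H' β.toContinuousMap hH'
  have hL : ∀ r u, F.proj (L (r, u)) = H (σ r, u) := fun r u =>
    congrFun (F.isCoveringMap.liftHomotopy_lifts H' β.toContinuousMap hH') (r, u)
  have hL0 : ∀ u, L (0, u) = β u := F.isCoveringMap.liftHomotopy_zero H' β.toContinuousMap hH'
  -- Both curves lift the track of the base point under the homotopy and start at the endpoint of β.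
  have hend : (fun r => L (r, 1)) = fun r => φ (L (r, 0)) :=
    F.isCoveringMap.eq_of_comp_eq (by fun_prop) (by fun_prop)
      (funext fun r => by
        simp only [Function.comp_apply]
        rw [hφ, hL, hL, Hp]) 0 (by simp [hL0])
  obtain ⟨c, hc, hcw⟩ := w.isGeodesic
  have hL1 : ∀ u, F.proj (L (1, u)) = w.toFun (u * w.length) := fun u => by
    rw [hL, unitInterval.symm_one, H0]; simp [ClosedGeodesic.loopAt]
  -- A deck transformation moves the given lift of `w` to the one starting where the lifted homotopy
  -- ends; then `φ` translates it by one period.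
  obtain ⟨ψ, hψ, hψ0⟩ := F.exists_isDeck_apply_eq (z := c 0) (w := L (1, 0)) (by
    rw [hcw, hL1]; simp)
  have hlift : IsLift w (ψ ∘ c) := ⟨hψ.isometry.comp hc, fun u => (hψ _).trans (hcw u)⟩
  have hseg : (fun u : I => (ψ ∘ c) (u * w.length)) = fun u => L (1, u) := by
    have := hlift.1.continuous
    refine F.isCoveringMap.eq_of_comp_eq
      (this.comp (f := fun u : I => (u : ℝ) * w.length) (by fun_prop)) (by fun_prop)
      (funext fun u => ?_) 0 (by simpa using hψ0)
    simp only [Function.comp_apply (f := F.proj)]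
    rw [hlift.2, hL1]
  have h1 : (ψ ∘ c) w.length = φ ((ψ ∘ c) 0) := by
    have e1 := congrFun hseg 1
    have e0 := congrFun hseg 0
    simp only [Set.Icc.coe_zero, Set.Icc.coe_one, zero_mul, one_mul] at e0 e1
    rw [e0, e1]
    exact congrFun hend 1
  have h2 := hlift.apply_add_length hφ h1.symm
  have h3 : ∀ u, g • (ψ ∘ c) u = (ψ ∘ c) (u + w.length) := fun u => by rw [← hg, h2]
  have h4 : ∀ u, g • a u = a (u + τ) := fun u => by rw [← hg, ha.translates]
  refine ⟨translation_length_unique hlift.1 ha.geodesic w.length_pos ha.pos h3 h4, ?_⟩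
  obtain ⟨u₀, hu₀⟩ := axis_unique hlift.1 ha.geodesic w.length_pos ha.pos h3 h4
  exact ⟨u₀, fun u => by rw [← hlift.2, hu₀]⟩

/-- The zigzag that lifts the loop product of two closed geodesics. -/
theorem ClosedGeodesic.exists_lift_loopProduct {x y : F.ClosedGeodesic} {s t : ℝ} {P : M}
    (hx : x.toFun s = P) (hy : y.toFun t = P) {xl yl : ℝ → ℍ} (hxl : IsLift x xl)
    (hyl : IsLift y yl) (hst : xl s = yl t) {X Y : ℍ ≃ₜ ℍ} (hX : F.IsDeck X)
    (hXx : X (xl s) = xl (s + x.length)) (hYy : Y (yl t) = yl (t + y.length)) :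
    ∃ β : Path (xl s) ((Y.trans X) (xl s)),
      ∀ u, F.proj (β u) = x.loopProduct y s t P hx hy u := by
  have hcx := hxl.1.continuous
  have hcy := hyl.1.continuous
  let β₁ : Path (xl s) (X (xl s)) :=
    ⟨⟨fun u => xl (s + u * x.length), by fun_prop⟩, by simp, by simp [hXx]⟩
  let β₂ : Path (X (xl s)) ((Y.trans X) (xl s)) :=
    ⟨⟨fun u => X (yl (t + u * y.length)), by fun_prop⟩, by simp [hst], by simp [hst, hYy]⟩
  refine ⟨β₁.trans β₂, fun u => ?_⟩
  rw [loopProduct, Path.trans_apply, Path.trans_apply]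
  split_ifs with h
  · exact hxl.2 _
  · exact (hX _).trans (hyl.2 _)

/-- The point halfway before the vertex on one line and the point halfway behind it on the other
line coincide only if each of the closed geodesics is the other one run backwards. -/
theorem IsLift.eq_reverse {x y : F.ClosedGeodesic} {xl yl : ℝ → ℍ} (hxl : IsLift x xl)
    (hyl : IsLift y yl) {s t : ℝ} (hst : xl s = yl t)
    (h : yl (t - y.length / 2) = xl (s + x.length / 2)) :
    y.length = x.length ∧ ∀ u, y.toFun (t + u) = x.toFun (s - u) := by
  -- The common point lies at half of each length from the common vertex.
  have hlen : y.length / 2 = x.length / 2 := by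
    have h1 := hxl.1.dist_eq s (s + x.length / 2)
    rw [← h, hst, hyl.1.dist_eq, Real.dist_eq, Real.dist_eq, sub_sub_cancel, sub_add_cancel_left,
      abs_neg, abs_of_pos (half_pos y.length_pos), abs_of_pos (half_pos x.length_pos)] at h1
    exact h1
  refine ⟨by linarith, fun u => ?_⟩
  rw [← hxl.2, ← hyl.2]
  refine congrArg F.proj (isometry_ext (c := fun u => yl (t + u)) (d := fun u => xl (s - u))
    (hyl.1.comp (isometry_add_left t)) (hxl.1.comp (IsometryEquiv.subLeft s).isometry)
    (neg_lt_zero.2 (half_pos y.length_pos)).ne ?_ ?_ u)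
  · rw [← sub_eq_add_neg, h, sub_neg_eq_add, hlen]
  · rw [add_zero, sub_zero, hst]

end HyperbolicSurface

/-! ### Products of half-turns and the main theorem -/

/-- The composition of the translations along two lines through a point is a translation along the
line through the points halfway along the translation segments. -/
theorem translation_comp_translation {gX gY : SL(2, ℝ)} {c d a : ℝ → ℍ} {s t τ ρ δ : ℝ}
    (hc : Isometry c) (hd : Isometry d) (ha : Isometry a) (hst : c s = d t)
    (hX : ∀ u, gX • c u = c (u + τ)) (hY : ∀ u, gY • d u = d (u + ρ))
    (ha0 : a 0 = c (s + τ / 2)) (haδ : a (-δ) = d (t - ρ / 2)) (u : ℝ) :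
    gX • gY • a u = a (u + 2 * δ) := by
  obtain ⟨rS, hS⟩ := exists_pointReflection (c (s + τ / 2))
  obtain ⟨rP, hP⟩ := exists_pointReflection (c s)
  obtain ⟨rT, hT⟩ := exists_pointReflection (d (t - ρ / 2))
  have hPP : ∀ z : ℍ, rP • rP • z = z := fun z => by
    have := smul_eq_of_eq_on_line (g := rP * rP) (g' := 1) hc (fun v => by
      have e1 := hP c hc s rfl (v - s)
      have e2 := hP c hc s rfl (s - v)
      rw [add_sub_cancel] at e1
      rw [sub_sub_cancel] at e2
      rw [mul_smul, e1, one_smul, ← e2]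
      congr 2; ring) z
    rwa [mul_smul, one_smul] at this
  -- The half-turns about two points of `c` at distance τ/2 compose to the translation by τ;
  -- agreement on the line suffices.
  have hX' : ∀ z : ℍ, gX • z = (rS * rP) • z := smul_eq_of_eq_on_line hc fun v => by
    have e1 := hP c hc s rfl (v - s)
    have e2 := hS c hc _ rfl (s - v - τ / 2)
    rw [add_sub_cancel] at e1
    rw [hX, mul_smul, e1, show s - (v - s) = s + τ / 2 + (s - v - τ / 2) by ring, e2]
    congr 1; ring
  have hY' : ∀ z : ℍ, gY • z = (rP * rT) • z := smul_eq_of_eq_on_line hd fun v => by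
    have e1 := hT d hd _ rfl (v - t + ρ / 2)
    have e2 := hP d hd t hst.symm (t - v - ρ)
    rw [show t - ρ / 2 + (v - t + ρ / 2) = v by ring] at e1
    rw [hY, mul_smul, e1, show t - ρ / 2 - (v - t + ρ / 2) = t + (t - v - ρ) by ring, e2]
    congr 1; ring
  have e1 := hT a ha _ haδ (u + δ)
  have e2 := hS a ha _ ha0 (-u - 2 * δ)
  rw [show -δ + (u + δ) = u by ring] at e1
  rw [hX', hY', mul_smul, mul_smul, hPP, e1, show -δ - (u + δ) = 0 + (-u - 2 * δ) by ring, e2]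
  congr 1; ring

theorem isHypMidpoint_of_isometry {c : ℝ → ℍ} (hc : Isometry c) (s : ℝ) {τ : ℝ} (hτ : 0 < τ) :
    IsHypMidpoint (c s) (c (s + τ / 2)) (c (s + τ)) := by
  have h1 : dist (c s) (c (s + τ)) = τ := by
    rw [hc.dist_eq, Real.dist_eq, sub_add_cancel_left, abs_neg, abs_of_pos hτ]
  constructor <;> rw [h1, hc.dist_eq, Real.dist_eq]
  · rw [sub_add_cancel_left, abs_neg, abs_of_pos (half_pos hτ)]
  · rw [show s + τ / 2 - (s + τ) = -(τ / 2) by ring, abs_neg, abs_of_pos (half_pos hτ)]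

theorem IsHypMidpoint.map {A S B : ℍ} (h : IsHypMidpoint A S B) {φ : ℍ → ℍ} (hφ : Isometry φ) :
    IsHypMidpoint (φ A) (φ S) (φ B) := by
  simpa only [IsHypMidpoint, hφ.dist_eq] using h

theorem Isometry.homeomorph_symm {φ : ℍ ≃ₜ ℍ} (h : Isometry φ) : Isometry φ.symm :=
  h.right_inv φ.apply_symm_apply

theorem mainTheorem2 {M : Type*} [TopologicalSpace M] (F : HyperbolicSurface M)
    (x y : F.ClosedGeodesic) (s t : ℝ) (P : M)
    (hx : x.toFun s = P) (hy : y.toFun t = P)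
    -- `y` is not the geodesic `x` run backwards from `P`
    (hxy : ¬ (y.length = x.length ∧ ∀ u, y.toFun (t + u) = x.toFun (s - u)))
    -- a lift of `P` and the lifts of `x` and `y` through it
    (P' : ℍ) (xl yl : ℝ → ℍ)
    (hxl : HyperbolicSurface.IsLift x xl) (hyl : HyperbolicSurface.IsLift y yl)
    (hxP : xl s = P') (hyP : yl t = P') :
    ∃ (X Y : ℍ ≃ₜ ℍ) (S T : ℍ) (a : ℝ → ℍ) (z : F.ClosedGeodesic),
      -- the deck transformations of `x` and `y`
      F.IsDeck X ∧ IsHyperbolicAlong X xl x.length ∧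
      F.IsDeck Y ∧ IsHyperbolicAlong Y yl y.length ∧
      -- the midpoints of consecutive segments of the zigzag, which lifts the loop product from `P'`
      IsHypMidpoint P' S (X P') ∧ IsHypMidpoint (X P') T (X (Y P')) ∧
      -- the axis of `X ∘ Y` is the line from `S` to `T`
      IsHyperbolicAlong (X ∘ Y) a z.length ∧
      a 0 = S ∧ a (dist S T) = T ∧
      -- `Y ∘ X` is hyperbolic, and its axis joins the midpoints of the segments meeting at `P'`
      IsHyperbolicAlong (Y ∘ X) (X.symm ∘ a) z.length ∧
      IsHypMidpoint (X.symm P') (X.symm S) P' ∧ IsHypMidpoint P' (X.symm T) (Y P') ∧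
      -- the projection of the axis is the unique closed geodesic in the class of the loop product
      (∀ u, z.toFun u = F.proj (a u)) ∧
      z.InFreeClass (x.loopProduct y s t P hx hy) ∧
      (∀ w : F.ClosedGeodesic, w.InFreeClass (x.loopProduct y s t P hx hy) →
        w.length = z.length ∧ ∃ u₀, ∀ u, w.toFun u = z.toFun (u + u₀)) ∧
      -- it passes through the midpoints of `x` and `y` with respect to `P`
      F.proj S = x.midpoint s ∧ F.proj T = y.midpoint t ∧
      z.toFun 0 = x.midpoint s ∧ z.toFun (z.length / 2) = y.midpoint t ∧
      -- its length
      z.length = 2 * dist S T ∧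
      Real.cosh (z.length / 2) =
        Real.cosh (x.length / 2) * Real.cosh (y.length / 2) -
          Real.sinh (x.length / 2) * Real.sinh (y.length / 2) *
            Real.cos (turningInteriorAngle xl yl s t) := by
  subst hx hxP
  obtain ⟨X, hX, hXx⟩ := hxl.exists_isDeck
  obtain ⟨Y, hY, hYy⟩ := hyl.exists_isDeck
  obtain ⟨gX, -, hgX⟩ := hXx.hyperbolic
  obtain ⟨gY, -, hgY⟩ := hYy.hyperbolic
  have hXs := hX.isometry.homeomorph_symm
  set S := xl (s + x.length / 2) with hS
  -- This is the preimage of `T` under X ∘ Y, on the y-segment arriving at P'.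
  set T₀ := yl (t - y.length / 2) with hT₀
  set δ := dist T₀ S with hδ
  -- If the two points coincided, X ∘ Y would be the identity.
  have hδ0 : 0 < δ := dist_pos.2 fun h => hxy (hxl.eq_reverse hyl hyP.symm h)
  obtain ⟨k, hk0, hk1⟩ := exists_smul_imAxis T₀ S
  let a : ℝ → ℍ := fun u => k • imAxis (u + δ)
  have ha : Isometry a := (isometry_smul_imAxis k).comp (isometry_add_right δ)
  have ha0 : a 0 = S := by simp only [a, zero_add, hδ, hk1]
  have haδ : a (-δ) = T₀ := by simp only [a, neg_add_cancel, hk0]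
  have hXY : ∀ u, X (Y (a u)) = a (u + 2 * δ) := fun u => by
    rw [hgX, hgY]
    exact translation_comp_translation hxl.1 hyl.1 ha hyP.symm
      (fun u => by rw [← hgX, hXx.translates]) (fun u => by rw [← hgY, hYy.translates]) ha0 haδ u
  have hdeck : F.IsDeck (Y.trans X) := hY.trans hX
  have hXYa : IsHyperbolicAlong (Y.trans X) a (2 * δ) :=
    .of_translates ⟨gX * gY, fun z => by rw [mul_smul, ← hgY, ← hgX]; rfl⟩ ha (by positivity) hXY
  have hYT : Y T₀ = yl (t + y.length / 2) := by
    rw [hT₀, hYy.translates]; congr 1; ring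
  -- X ∘ Y moves `T₀`, at parameter -δ, by 2δ, so `S` is halfway between `T₀` and `T`.
  have hT : a δ = X (yl (t + y.length / 2)) := by
    rw [← hYT, ← haδ, hXY]; congr 1; ring
  have hdist : dist S (X (yl (t + y.length / 2))) = δ := by
    rw [← hT, ← ha0, ha.dist_eq, Real.dist_eq, zero_sub, abs_neg, abs_of_pos hδ0]
  have hmx : IsHypMidpoint (xl s) S (X (xl s)) := by
    rw [hXx.translates]; exact isHypMidpoint_of_isometry hxl.1 s x.length_pos
  have hmy : IsHypMidpoint (xl s) (yl (t + y.length / 2)) (Y (xl s)) := by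
    rw [← hyP, hYy.translates]; exact isHypMidpoint_of_isometry hyl.1 t y.length_pos
  let z : F.ClosedGeodesic := ⟨fun u => F.proj (a u), 2 * δ, by positivity,
    fun u => by simp only [← hXY]; exact hdeck (a u), a, ha, fun _ => rfl⟩
  obtain ⟨β, hβ⟩ := HyperbolicSurface.ClosedGeodesic.exists_lift_loopProduct rfl hy hxl hyl
    hyP.symm (Y := Y) hX (hXx.translates s) (hYy.translates t)
  have hpS : F.proj S = x.midpoint s := hxl.2 _
  have hpT : F.proj (X (yl (t + y.length / 2))) = y.midpoint t := (hX _).trans (hyl.2 _)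
  refine ⟨X, Y, S, X (yl (t + y.length / 2)), a, z, hX, hXx, hY, hYy, hmx,
    hmy.map hX.isometry, hXYa, ha0, by rw [hdist, hT], ?_, ?_, ?_, fun _ => rfl,
    HyperbolicSurface.ClosedGeodesic.inFreeClass_of_axis (z := z) hdeck hXYa (fun _ => rfl) β _ hβ,
    fun w hw => hw.eq_axis hdeck hXYa β hβ, hpS, hpT, ?_, ?_, ?_, ?_⟩
  -- Y ∘ X is the conjugate of X ∘ Y by X⁻¹, so its axis is the image of `a` under X⁻¹.
  · exact .of_translates ⟨gY * gX, fun z => by rw [mul_smul, ← hgX, ← hgY]; rfl⟩ (hXs.comp ha)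
      hXYa.pos fun u => by
        simp only [Function.comp_apply, X.apply_symm_apply]
        rw [X.eq_symm_apply, hXY]
  · simpa using hmx.map hXs
  · simpa using hmy
  · change F.proj (a 0) = _
    rw [ha0, hpS]
  · change F.proj (a (2 * δ / 2)) = _
    rw [mul_div_cancel_left₀ _ two_ne_zero, hT, hpT]
  · rw [hdist]
  · change Real.cosh (2 * δ / 2) = _
    rw [mul_div_cancel_left₀ _ two_ne_zero, hδ, dist_comm, hS, hT₀,
      cosh_dist_geodesics hxl.1 hyl.1 hyP.symm]
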